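/- Let $G$ be a finite simple connected graph on $n$ vertices with exactly $n+1$ edges (a \emph{bicyclic} graph). Let $\mathbf{X}_G=\sum_{\kappa}\prod_{v\in V(G)}x_{\kappa(v)}$, summed over all proper colorings $\kappa:V(G)\to\mathbb{N}$, be its chromatic symmetric function. For $k\ge 1$ let $\mathfrak{st}_k$ be the chromatic symmetric function of the star graph on $k$ vertices (one central vertex joined to $k-1$ leaves), and for a partition $\lambda=(\lambda_1,\dots,\lambda_r)$ of $n$ put $\mathfrak{st}_\lambda=\mathfrak{st}_{\lambda_1}\cdots\mathfrak{st}_{\lambda_r}$. Then there is a unique family of rational coefficients $(c_\lambda)_{\lambda\vdash n}$ with $$\mathbf{X}_G=\sum_{\lambda\vdash n}c_\lambda\,\mathfrak{st}_\lambda ,$$ and its coefficient $c_{(n)}$ at the one-part partition $(n)$ is as follows. 1. Suppose that $G$ is of type I with cycles of lengths $s,t\ge 3$: a minimal bicyclic subgraph of $G$ consists of a cycle of length $s$, a cycle of length $t$ and a path between them, where either the two cycles are vertex-disjoint and the path joins a vertex of one to a vertex of the other and has no further vertex in common with either cycle, or the path is a single vertex and this is the only common vertex of the two cycles. Then $$c_{(n)}=(s-1)(t-1).$$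 2. Suppose that $G$ is of type II with cycles of lengths $s,t\ge 3$ sharing a path with $\ell\ge 1$ edges: a minimal bicyclic subgraph of $G$ consists of three paths with $k,\ell,m\ge 1$ edges between the same two vertices $u$ and $v$, with pairwise disjoint edge sets and pairwise no common vertex other than $u$ and $v$, where $s=k+\ell$ and $t=\ell+m$. Then $$c_{(n)}=(s-1)(t-1)-2\binom{\ell}{2}.$$ -/

import Mathlib

/-- The exponent vector of the monomial `∏ v, x_{κ v}` attached to a map `κ : V → ℕ`. -/
noncomputable def colorMonomial {V : Type*} [Fintype V] (κ : V → ℕ) : ℕ →₀ ℕ :=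
  ∑ v, Finsupp.single (κ v) 1

/-- The chromatic symmetric function `X_G = ∑_κ ∏ v, x_{κ v}`, the sum being over all proper
colourings `κ : V → ℕ` of `G`, as a formal power series in the variables `x_0, x_1, …` with
rational coefficients: the coefficient of a monomial is the number of proper colourings that
contribute that monomial (always a finite number, see `finite_coloring_of_colorMonomial`). -/
noncomputable def chromaticSymm {V : Type*} [Fintype V] (G : SimpleGraph V) :
    MvPowerSeries ℕ ℚ :=
  fun d => (Nat.card {κ : G.Coloring ℕ // colorMonomial (fun v => κ v) = d} : ℚ)

/-- Only finitely many proper colourings contribute a given monomial. -/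
theorem finite_coloring_of_colorMonomial {V : Type*} [Fintype V] (G : SimpleGraph V)
    (d : ℕ →₀ ℕ) : Finite {κ : G.Coloring ℕ // colorMonomial (fun v => κ v) = d} := by
  have h : ∀ (κ : {κ : G.Coloring ℕ // colorMonomial (fun v => κ v) = d}) (v : V),
      κ.1 v ∈ d.support := by
    rintro ⟨κ, rfl⟩ v
    rw [Finsupp.mem_support_iff]
    unfold colorMonomial
    rw [Finsupp.finsetSum_apply]
    intro h0
    rw [Finset.sum_eq_zero_iff] at h0
    simpa using h0 v (Finset.mem_univ v)
  refine Finite.of_injective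
    (fun κ => (fun v => (⟨κ.1 v, h κ v⟩ : d.support))) ?_
  intro κ κ' hκ
  apply Subtype.ext
  apply DFunLike.ext
  intro v
  exact congrArg Subtype.val (congrFun hκ v)

/-- `𝔰𝔱_k`, the chromatic symmetric function of the star graph on `k` vertices
(with the convention that it is `1` for `k = 0`, which never occurs as a part). -/
noncomputable def starSymm : ℕ → MvPowerSeries ℕ ℚ
  | 0 => 1
  | k + 1 => chromaticSymm (SimpleGraph.starGraph (0 : Fin (k + 1)))

/-- `𝔰𝔱_μ`, the product of the `𝔰𝔱_k` over the parts `k` of the partition `μ`. -/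
noncomputable def starSymmPartition {n : ℕ} (μ : n.Partition) : MvPowerSeries ℕ ℚ :=
  (μ.parts.map starSymm).prod

/-- `c` is a family of coefficients of an expansion `X_G = ∑_{μ ⊢ n} c_μ 𝔰𝔱_μ`. -/
def IsStarExpansion {V : Type*} [Fintype V] (G : SimpleGraph V) {n : ℕ}
    (c : n.Partition → ℚ) : Prop :=
  chromaticSymm G = ∑ μ : n.Partition, c μ • starSymmPartition μ

/-- A (simple) graph is bicyclic if it is connected and has one more edge than vertices. -/
def IsBicyclic {V : Type*} (G : SimpleGraph V) : Prop :=
  G.Connected ∧ G.edgeSet.ncard = Nat.card V + 1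

/-- `H` is a minimal bicyclic subgraph of `G`. -/
def IsMinimalBicyclic {V : Type*} {G : SimpleGraph V} (H : G.Subgraph) : Prop :=
  Minimal (fun K : G.Subgraph => IsBicyclic K.coe) H

/-- `H` consists of a cycle `C` of length `s`, a cycle `D` of length `t` and a path `P`
(possibly a single vertex) from a vertex `u` of `C` to a vertex `v` of `D`, where `P` meets `C`
only in `u` and `D` only in `v`. If `u ≠ v`, the two cycles have no vertex in common;
if `u = v`, the path is trivial and `u` is the only common vertex of the cycles. -/
def IsTwoCyclesJoined {V : Type*} {G : SimpleGraph V} (H : G.Subgraph) (s t : ℕ) : Prop :=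
  ∃ (u v : V) (C : G.Walk u u) (D : G.Walk v v) (P : G.Walk u v),
    C.IsCycle ∧ D.IsCycle ∧ P.IsPath ∧ C.length = s ∧ D.length = t ∧
    (∀ x ∈ P.support, x ∈ C.support → x = u) ∧
    (∀ x ∈ P.support, x ∈ D.support → x = v) ∧
    (∀ x ∈ C.support, x ∈ D.support → x = u ∧ x = v) ∧
    H = C.toSubgraph ⊔ D.toSubgraph ⊔ P.toSubgraph

/-- `H` consists of three paths `P`, `Q`, `R` with at least one edge each from a vertex `u` to
a vertex `v`, with pairwise disjoint edge sets and pairwise no common vertices other than `u`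
and `v`. The path `Q` has `ℓ` edges, the cycle formed by `P` and `Q` has length `s`, and the
cycle formed by `Q` and `R` has length `t`. -/
def IsTwoCyclesSharingPath {V : Type*} {G : SimpleGraph V} (H : G.Subgraph) (s t ℓ : ℕ) :
    Prop :=
  ∃ (u v : V) (P Q R : G.Walk u v),
    P.IsPath ∧ Q.IsPath ∧ R.IsPath ∧
    1 ≤ P.length ∧ 1 ≤ Q.length ∧ 1 ≤ R.length ∧
    Q.length = ℓ ∧ P.length + Q.length = s ∧ Q.length + R.length = t ∧
    P.edges.Disjoint Q.edges ∧ Q.edges.Disjoint R.edges ∧ P.edges.Disjoint R.edges ∧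
    (∀ x ∈ P.support, x ∈ Q.support → x = u ∨ x = v) ∧
    (∀ x ∈ Q.support, x ∈ R.support → x = u ∨ x = v) ∧
    (∀ x ∈ P.support, x ∈ R.support → x = u ∨ x = v) ∧
    H = P.toSubgraph ⊔ Q.toSubgraph ⊔ R.toSubgraph

/-- A type-I bicyclic graph formed by cycles of lengths `s` and `t`. -/
def IsBicyclicTypeI {V : Type*} (G : SimpleGraph V) (s t : ℕ) : Prop :=
  IsBicyclic G ∧ ∃ H : G.Subgraph, IsMinimalBicyclic H ∧ IsTwoCyclesJoined H s t

/-- A type-II bicyclic graph formed by cycles of lengths `s` and `t` which meet along a path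
with `ℓ` edges. -/
def IsBicyclicTypeII {V : Type*} (G : SimpleGraph V) (s t ℓ : ℕ) : Prop :=
  IsBicyclic G ∧ ∃ H : G.Subgraph, IsMinimalBicyclic H ∧ IsTwoCyclesSharingPath H s t ℓ

/-! Stanley's expansion writes `X_G` as the sum over edge sets `S` of `(-1)^|S|` times the product
of the power sums `p_k`, with `k` running over the component sizes of `S`. Modulo products of at
least two stars (`starSpan n 2`) only connected spanning `S` survive, so `X_G ≡ a(G) p_n`, where
`a(G)` is `connectedSpanningSum G`. A star is a tree, whose only connected spanning subgraph is
itself; hence `𝔰𝔱_n ≡ (-1)^(n-1) p_n`, and `X_G` has an expansion with `c_(n) = (-1)^(n-1) a(G)`.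

Uniqueness: the products `p_μ` are linearly independent by triangularity against monomials, and they
lie in the span of the equally many `𝔰𝔱_μ`.

It remains to compute `a(G)`. Passing to complements `F` of `S`, the signs cancel because there are
`n + 1` edges, and `c_(n) = ∑ (-1)^|F|` over the `F` with `G - F` connected. Such an `F` has at most
two edges, so the sum is 1 minus the number of non-bridges plus the number of removable pairs. In
type I the non-bridges are the edges of the two cycles and a removable pair takes one edge from
each: `1 - (s + t) + st`. In type II they are the edges of the three paths and a removable pair
takes edges from two different paths: `1 - (k + ℓ + m) + (kℓ + ℓm + km)`. Both counts use only that
an edge of a cycle untouched by `F` may be added to `F` (`Augments`), together with the bound `|F| ≤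
2`. -/

/-! ### Power sums and Stanley's expansion -/

open Classical in
/-- The power sum `∑ i, x_i ^ k`, for `k ≥ 1`, as a formal power series. -/
noncomputable def powerSumSeries (k : ℕ) : MvPowerSeries ℕ ℚ :=
  fun d => if ∃ i, Finsupp.single i k = d then 1 else 0

open Classical in
theorem coeff_powerSumSeries (k : ℕ) (d : ℕ →₀ ℕ) :
    MvPowerSeries.coeff d (powerSumSeries k) = if ∃ i, Finsupp.single i k = d then 1 else 0 :=
  rfl

/-- The coefficient of a monomial in a product of power sums counts the ways to choose one
variable in each factor. -/
theorem coeff_prod_powerSumSeries {ι : Type*} [Fintype ι] (f : ι → ℕ) (hf : ∀ i, 0 < f i)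
    (d : ℕ →₀ ℕ) :
    MvPowerSeries.coeff d (∏ i, powerSumSeries (f i)) =
      (Nat.card {g : ι → ℕ // ∑ i, Finsupp.single (g i) (f i) = d} : ℚ) := by
  classical
  have hprod : ∀ l : ι →₀ ℕ →₀ ℕ,
      ∏ i, MvPowerSeries.coeff (l i) (powerSumSeries (f i)) =
        if ∀ i, ∃ j, Finsupp.single j (f i) = l i then (1 : ℚ) else 0 := by
    intro l
    split_ifs with h
    · exact Finset.prod_eq_one fun i _ => by rw [coeff_powerSumSeries, if_pos (h i)]
    · push Not at h
      obtain ⟨i, hi⟩ := h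
      refine Finset.prod_eq_zero (Finset.mem_univ i) ?_
      rw [coeff_powerSumSeries, if_neg (by simpa using hi)]
  rw [MvPowerSeries.coeff_prod, Finset.sum_congr rfl (fun l _ => hprod l), Finset.sum_boole]
  norm_cast
  rw [← Fintype.card_coe, ← Nat.card_eq_fintype_card]
  symm
  refine Nat.card_congr (Equiv.ofBijective
    (fun g => ⟨Finsupp.equivFunOnFinite.symm fun i => Finsupp.single (g.1 i) (f i), ?_⟩)
    ⟨?_, ?_⟩)
  · rw [Finset.mem_filter, Finset.mem_finsuppAntidiag]
    exact ⟨⟨by simpa using g.2, Finset.subset_univ _⟩, fun i => ⟨g.1 i, by simp⟩⟩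
  · intro g g' h
    apply Subtype.ext
    funext i
    have := congrFun (congrArg (fun l : ι →₀ ℕ →₀ ℕ => (l : ι → ℕ →₀ ℕ))
      (congrArg Subtype.val h)) i
    -- Positivity matters: `single j 0 = 0` would forget the chosen variable `j`.
    exact Finsupp.single_left_injective (hf i).ne' (by simpa using this)
  · rintro ⟨l, hl⟩
    rw [Finset.mem_filter, Finset.mem_finsuppAntidiag] at hl
    choose g hg using hl.2
    refine ⟨⟨g, by simpa [hg] using hl.1.1⟩, Subtype.ext ?_⟩
    ext1 i
    simp [hg]

/-- A map is constant on the connected components of a graph as soon as it takes equal values on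
adjacent vertices. -/
theorem exists_eq_comp_connectedComponentMk {V α : Type*} (H : SimpleGraph V) (κ : V → α)
    (h : ∀ u v, H.Adj u v → κ u = κ v) :
    ∃ g : H.ConnectedComponent → α, ∀ v, g (H.connectedComponentMk v) = κ v := by
  refine ⟨SimpleGraph.ConnectedComponent.lift κ ?_, fun v => rfl⟩
  intro v w p hp
  clear hp
  induction p with
  | nil => rfl
  | cons hadj p ih => exact (h _ _ hadj).trans ih

theorem colorMonomial_comp_connectedComponentMk {V : Type*} [Fintype V] (H : SimpleGraph V)
    [Fintype H.ConnectedComponent] (g : H.ConnectedComponent → ℕ) :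
    colorMonomial (fun v => g (H.connectedComponentMk v)) =
      ∑ c : H.ConnectedComponent, Finsupp.single (g c) (Nat.card c.supp) := by
  classical
  unfold colorMonomial
  rw [← Finset.sum_fiberwise Finset.univ (fun v => H.connectedComponentMk v)]
  refine Finset.sum_congr rfl fun c _ => ?_
  have hconst : ∀ v ∈ Finset.univ.filter (fun v => H.connectedComponentMk v = c),
      Finsupp.single (g (H.connectedComponentMk v)) 1 = Finsupp.single (g c) 1 := by
    intro v hv
    rw [(Finset.mem_filter.1 hv).2]
  rw [Finset.sum_congr rfl hconst, Finset.sum_const, Finsupp.smul_single, smul_eq_mul, mul_one,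
    Nat.subtype_card (Finset.univ.filter (fun v => H.connectedComponentMk v = c))]
  simp [SimpleGraph.ConnectedComponent.mem_supp_iff]

/-- The number of maps with a given monomial that are constant on the components of `H`. -/
theorem card_monochromatic_eq_coeff {V : Type*} [Fintype V] (H : SimpleGraph V)
    [Fintype H.ConnectedComponent] (d : ℕ →₀ ℕ) :
    (Nat.card {κ : V → ℕ // colorMonomial κ = d ∧ ∀ u v, H.Adj u v → κ u = κ v} : ℚ) =
      MvPowerSeries.coeff d
        (∏ c : H.ConnectedComponent, powerSumSeries (Nat.card c.supp)) := by
  rw [coeff_prod_powerSumSeries]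
  · norm_cast
    symm
    refine Nat.card_congr (Equiv.ofBijective
      (fun g => ⟨fun v => g.1 (H.connectedComponentMk v), ?_, ?_⟩) ⟨?_, ?_⟩)
    · rw [colorMonomial_comp_connectedComponentMk, g.2]
    · intro u v huv
      exact congrArg g.1 (SimpleGraph.ConnectedComponent.sound huv.reachable)
    · intro g g' h
      apply Subtype.ext
      funext c
      induction c using SimpleGraph.ConnectedComponent.ind with
      | h v => exact congrFun (congrArg Subtype.val h) v
    · rintro ⟨κ, hκ, hH⟩
      obtain ⟨g, hg⟩ := exists_eq_comp_connectedComponentMk H κ hH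
      obtain rfl : (fun v => g (H.connectedComponentMk v)) = κ := funext hg
      exact ⟨⟨g, by rw [← colorMonomial_comp_connectedComponentMk, hκ]⟩, rfl⟩
  · intro c
    have := c.nonempty_supp.to_subtype
    exact Nat.card_pos

theorem finite_colorMonomial_eq {V : Type*} [Fintype V] (d : ℕ →₀ ℕ) :
    {κ : V → ℕ | colorMonomial κ = d}.Finite := by
  have := finite_coloring_of_colorMonomial (⊥ : SimpleGraph V) d
  refine Set.Finite.subset (Set.finite_range
    (fun κ : {κ : (⊥ : SimpleGraph V).Coloring ℕ // colorMonomial (fun v => κ v) = d} =>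
      fun v => κ.1 v)) ?_
  intro κ hκ
  exact ⟨⟨SimpleGraph.Coloring.mk κ (fun h => h.elim), hκ⟩, rfl⟩

open Classical in
/-- Stanley's expansion of the chromatic symmetric function in power sums. -/
theorem chromaticSymm_eq_sum_powerSumSeries {V : Type*} [Fintype V] (G : SimpleGraph V) :
    chromaticSymm G = ∑ S ∈ G.edgeFinset.powerset, (-1 : ℚ) ^ S.card •
      ∏ c : (SimpleGraph.fromEdgeSet (S : Set (Sym2 V))).ConnectedComponent,
        powerSumSeries (Nat.card c.supp) := by
  ext d
  -- All maps with monomial `d`, proper or not: a finite index set that allows the two sums to be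
  -- exchanged.
  set K := (finite_colorMonomial_eq (V := V) d).toFinset with hK
  have memK : ∀ κ, κ ∈ K ↔ colorMonomial κ = d := by simp [hK]
  have hmono : ∀ (S : Finset (Sym2 V)) (κ : V → ℕ), S ⊆ G.edgeFinset →
      ((∀ e ∈ S, (e.map κ).IsDiag) ↔
        ∀ u v, (SimpleGraph.fromEdgeSet (S : Set (Sym2 V))).Adj u v → κ u = κ v) := by
    intro S κ hS
    constructor
    · intro h u v huv
      simpa using h s(u, v) (by simpa using (SimpleGraph.fromEdgeSet_adj _ |>.1 huv).1)
    · intro h e he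
      induction e with
      | h u v =>
        -- `fromEdgeSet` discards loops; that `e` is an edge of `G` supplies `u ≠ v`.
        have := hS he
        simp only [SimpleGraph.mem_edgeFinset, SimpleGraph.mem_edgeSet] at this
        simpa using h u v ((SimpleGraph.fromEdgeSet_adj _).2 ⟨he, this.ne⟩)
  have h1 : MvPowerSeries.coeff d (chromaticSymm G) =
      ∑ κ ∈ K, if ∀ e ∈ G.edgeFinset, ¬ (e.map κ).IsDiag then (1 : ℚ) else 0 := by
    rw [Finset.sum_boole]
    change (Nat.card _ : ℚ) = _
    norm_cast
    rw [← Fintype.card_coe, ← Nat.card_eq_fintype_card]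
    refine Nat.card_congr (Equiv.ofBijective (fun κ => ⟨fun v => κ.1 v, ?_⟩) ⟨?_, ?_⟩)
    · rw [Finset.mem_filter, memK]
      refine ⟨κ.2, fun e he => ?_⟩
      induction e with
      | h u v =>
        simp only [SimpleGraph.mem_edgeFinset, SimpleGraph.mem_edgeSet] at he
        simpa using κ.1.valid he
    · intro κ κ' h
      exact Subtype.ext (DFunLike.coe_injective (congrArg Subtype.val h))
    · rintro ⟨κ, hκ⟩
      rw [Finset.mem_filter, memK] at hκ
      exact ⟨⟨SimpleGraph.Coloring.mk κ (fun {u v} h => by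
        simpa using hκ.2 s(u, v) (by simpa using h)), hκ.1⟩, rfl⟩
  -- Inclusion-exclusion: expand the product over the edges of `1 - [e is monochromatic]`.
  have h2 : ∀ κ : V → ℕ,
      (if ∀ e ∈ G.edgeFinset, ¬ (e.map κ).IsDiag then (1 : ℚ) else 0) =
      ∑ S ∈ G.edgeFinset.powerset, (-1 : ℚ) ^ S.card *
        if ∀ e ∈ S, (e.map κ).IsDiag then 1 else 0 := by
    intro κ
    have hleft : (if ∀ e ∈ G.edgeFinset, ¬ (e.map κ).IsDiag then (1 : ℚ) else 0) =
        ∏ e ∈ G.edgeFinset, if ¬ (e.map κ).IsDiag then (1 : ℚ) else 0 := by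
      rw [Finset.prod_boole]
      congr
    have : ∀ e : Sym2 V, (if ¬ (e.map κ).IsDiag then (1 : ℚ) else 0) =
        1 + (-1) * (if (e.map κ).IsDiag then 1 else 0) := by
      intro e; split_ifs <;> simp_all
    rw [hleft, Finset.prod_congr rfl (fun e _ => this e), Finset.prod_one_add]
    refine Finset.sum_congr rfl fun S _ => ?_
    rw [Finset.prod_mul_distrib, Finset.prod_const, Finset.prod_boole]
    congr
  rw [h1, Finset.sum_congr rfl (fun κ _ => h2 κ), Finset.sum_comm, map_sum]
  refine Finset.sum_congr rfl fun S hS => ?_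
  rw [← Finset.mul_sum, map_smul, smul_eq_mul, ← card_monochromatic_eq_coeff, Finset.sum_boole]
  congr 1
  norm_cast
  refine (Nat.subtype_card _ fun κ => ?_).symm
  rw [Finset.mem_filter, memK, hmono S κ (Finset.mem_powerset.1 hS)]

/-! ### Reduction modulo products of at least two stars -/

/-- The span of the products of at least `k` star functions `starSymm i`, `i ≥ 1`, of total
degree `n`. -/
noncomputable def starSpan (n k : ℕ) : Submodule ℚ (MvPowerSeries ℕ ℚ) :=
  Submodule.span ℚ {x | ∃ m : Multiset ℕ, (∀ i ∈ m, 0 < i) ∧ m.sum = n ∧ k ≤ m.card ∧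
    x = (m.map starSymm).prod}

theorem starSpan_anti (n : ℕ) {k l : ℕ} (h : k ≤ l) : starSpan n l ≤ starSpan n k := by
  refine Submodule.span_mono ?_
  rintro x ⟨m, h1, h2, h3, h4⟩
  exact ⟨m, h1, h2, h.trans h3, h4⟩

theorem starSymm_mem_starSpan {n : ℕ} (hn : 0 < n) : starSymm n ∈ starSpan n 1 :=
  Submodule.subset_span ⟨{n}, by simpa using hn, by simp, by simp, by simp⟩

theorem one_mem_starSpan : (1 : MvPowerSeries ℕ ℚ) ∈ starSpan 0 0 :=
  Submodule.subset_span ⟨0, by simp, by simp, by simp, by simp⟩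

theorem mul_mem_starSpan {a b i j : ℕ} {x y : MvPowerSeries ℕ ℚ} (hx : x ∈ starSpan a i)
    (hy : y ∈ starSpan b j) : x * y ∈ starSpan (a + b) (i + j) := by
  have h : starSpan a i * starSpan b j ≤ starSpan (a + b) (i + j) := by
    unfold starSpan
    rw [Submodule.span_mul_span]
    refine Submodule.span_mono ?_
    rintro _ ⟨_, ⟨m, h1, h2, h3, rfl⟩, _, ⟨m', h1', h2', h3', rfl⟩, rfl⟩
    refine ⟨m + m', ?_, by simp [h2, h2'], by rw [Multiset.card_add]; omega, by simp⟩
    intro i hi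
    rcases Multiset.mem_add.1 hi with h | h
    exacts [h1 i h, h1' i h]
  exact h (Submodule.mul_mem_mul hx hy)

theorem prod_mem_starSpan {ι : Type*} (s : Finset ι) (f : ι → ℕ) (x : ι → MvPowerSeries ℕ ℚ)
    (h : ∀ i ∈ s, x i ∈ starSpan (f i) 1) :
    ∏ i ∈ s, x i ∈ starSpan (∑ i ∈ s, f i) s.card := by
  classical
  induction s using Finset.induction_on with
  | empty => simpa using one_mem_starSpan
  | insert a s ha ih =>
    rw [Finset.prod_insert ha, Finset.sum_insert ha, Finset.card_insert_of_notMem ha, add_comm _ 1]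
    exact mul_mem_starSpan (h a (Finset.mem_insert_self a s))
      (ih fun i hi => h i (Finset.mem_insert_of_mem hi))

theorem sum_card_supp_connectedComponent {V : Type*} [Fintype V] (H : SimpleGraph V)
    [Fintype H.ConnectedComponent] :
    ∑ c : H.ConnectedComponent, Nat.card c.supp = Fintype.card V := by
  classical
  rw [← Finset.card_univ,
    Finset.card_eq_sum_card_fiberwise (f := H.connectedComponentMk) (t := Finset.univ) (by simp)]
  refine Finset.sum_congr rfl fun c _ => ?_
  refine Nat.subtype_card _ ?_
  simp [SimpleGraph.ConnectedComponent.mem_supp_iff]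

open Classical in
/-- The signed number of connected spanning subgraphs of `G`. -/
noncomputable def connectedSpanningSum {V : Type*} [Fintype V] (G : SimpleGraph V) : ℚ :=
  ∑ S ∈ G.edgeFinset.powerset.filter fun S : Finset (Sym2 V) =>
    (SimpleGraph.fromEdgeSet (S : Set (Sym2 V))).Connected, (-1 : ℚ) ^ S.card

theorem prod_powerSumSeries_of_connected {V : Type*} [Fintype V] (H : SimpleGraph V)
    [Fintype H.ConnectedComponent] (hH : H.Connected) :
    ∏ c : H.ConnectedComponent, powerSumSeries (Nat.card c.supp) =
      powerSumSeries (Fintype.card V) := by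
  have := hH.preconnected.subsingleton_connectedComponent
  obtain ⟨v⟩ := hH.nonempty
  rw [← sum_card_supp_connectedComponent H, Fintype.prod_subsingleton _ (H.connectedComponentMk v),
    Fintype.sum_subsingleton _ (H.connectedComponentMk v)]

/-- With at least two components, each is smaller than `V`. Only power sums of smaller degree are
therefore needed in `hp`, which makes the result usable inside the induction on degree that
expresses `p_k` by stars. -/
theorem prod_powerSumSeries_mem_of_not_connected {V : Type*} [Fintype V] [Nonempty V]
    (H : SimpleGraph V) [Fintype H.ConnectedComponent] (hH : ¬ H.Connected)
    (hp : ∀ k, 0 < k → k < Fintype.card V → powerSumSeries k ∈ starSpan k 1) :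
    ∏ c : H.ConnectedComponent, powerSumSeries (Nat.card c.supp) ∈
      starSpan (Fintype.card V) 2 := by
  have hpos : ∀ c : H.ConnectedComponent, 0 < Nat.card c.supp := by
    intro c
    have := c.nonempty_supp.to_subtype
    exact Nat.card_pos
  have hcard : 2 ≤ Fintype.card H.ConnectedComponent := by
    by_contra! h
    refine hH ⟨fun u v => ?_⟩
    have := Fintype.card_le_one_iff_subsingleton.1 (Nat.le_of_lt_succ h)
    exact SimpleGraph.ConnectedComponent.exact (Subsingleton.elim _ _)
  have hlt : ∀ c : H.ConnectedComponent, Nat.card c.supp < Fintype.card V := by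
    intro c
    have : Nontrivial H.ConnectedComponent := Fintype.one_lt_card_iff_nontrivial.1 hcard
    obtain ⟨c', hc'⟩ := exists_ne c
    rw [← sum_card_supp_connectedComponent H]
    exact Finset.single_lt_sum (f := fun c : H.ConnectedComponent => Nat.card c.supp) hc'
      (Finset.mem_univ c) (Finset.mem_univ c') (hpos c') (fun _ _ _ => Nat.zero_le _)
  refine starSpan_anti _ hcard ?_
  rw [← sum_card_supp_connectedComponent H]
  exact prod_mem_starSpan Finset.univ _ _ fun c _ => hp _ (hpos c) (hlt c)

theorem chromaticSymm_sub_mem_starSpan {V : Type*} [Fintype V] [Nonempty V] (G : SimpleGraph V)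
    (hp : ∀ k, 0 < k → k < Fintype.card V → powerSumSeries k ∈ starSpan k 1) :
    chromaticSymm G - connectedSpanningSum G • powerSumSeries (Fintype.card V) ∈
      starSpan (Fintype.card V) 2 := by
  classical
  rw [chromaticSymm_eq_sum_powerSumSeries, connectedSpanningSum, Finset.sum_smul,
    ← Finset.sum_filter_add_sum_filter_not _
      (fun S : Finset (Sym2 V) => (SimpleGraph.fromEdgeSet (S : Set (Sym2 V))).Connected)]
  rw [add_sub_right_comm]
  refine Submodule.add_mem _ ?_ (Submodule.sum_mem _ fun S hS => Submodule.smul_mem _ _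
    (prod_powerSumSeries_mem_of_not_connected _ (Finset.mem_filter.1 hS).2 hp))
  convert Submodule.zero_mem _
  rw [sub_eq_zero]
  exact Finset.sum_congr rfl fun S hS => by
    rw [prod_powerSumSeries_of_connected _ (Finset.mem_filter.1 hS).2]

/-- A tree has only one connected spanning subgraph, itself. -/
theorem connectedSpanningSum_of_isTree {V : Type*} [Fintype V] (G : SimpleGraph V)
    (hG : G.IsTree) : connectedSpanningSum G = (-1 : ℚ) ^ (Fintype.card V - 1) := by
  classical
  have hcard : G.edgeFinset.card + 1 = Fintype.card V := hG.card_edgeFinset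
  rw [connectedSpanningSum, Finset.sum_eq_single G.edgeFinset]
  · rw [← hcard, Nat.add_sub_cancel]
  · intro S hS hne
    rw [Finset.mem_filter, Finset.mem_powerset] at hS
    -- A connected spanning subgraph needs as many edges as the tree has, so `S` is the full edge
    -- set.
    have h1 := hS.2.card_vert_le_card_edgeSet_add_one
    have h2 : Nat.card (SimpleGraph.fromEdgeSet (S : Set (Sym2 V))).edgeSet ≤ S.card := by
      rw [Nat.card_coe_set_eq, ← Set.ncard_coe_finset S]
      refine Set.ncard_le_ncard ?_ S.finite_toSet
      rw [SimpleGraph.edgeSet_fromEdgeSet]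
      exact Set.sdiff_subset
    rw [Nat.card_eq_fintype_card] at h1
    exact absurd (Finset.eq_of_subset_of_card_le hS.1 (by omega)) hne
  · intro h
    refine absurd ?_ h
    rw [Finset.mem_filter, Finset.mem_powerset]
    refine ⟨subset_rfl, ?_⟩
    rw [SimpleGraph.coe_edgeFinset, SimpleGraph.fromEdgeSet_edgeSet]
    exact hG.connected

/-- The star is a tree, so its signed sum is `(-1)^(n-1)`. The remaining terms involve `p_k` with `k
< n`, and by induction each of these is `±𝔰𝔱_k` up to products of stars. -/
theorem starSymm_sub_powerSumSeries_mem {n : ℕ} (hn : 0 < n) :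
    starSymm n - (-1 : ℚ) ^ (n - 1) • powerSumSeries n ∈ starSpan n 2 := by
  induction n using Nat.strong_induction_on with
  | _ n ih =>
    obtain ⟨m, rfl⟩ := Nat.exists_eq_succ_of_ne_zero hn.ne'
    have h := chromaticSymm_sub_mem_starSpan (SimpleGraph.starGraph (0 : Fin (m + 1))) ?_
    · rw [connectedSpanningSum_of_isTree _ (SimpleGraph.isTree_starGraph _),
        Fintype.card_fin] at h
      exact h
    · intro k hk hk'
      rw [Fintype.card_fin] at hk'
      have h := Submodule.sub_mem _ (starSymm_mem_starSpan hk)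
        (starSpan_anti k one_le_two (ih k hk' hk))
      rw [sub_sub_cancel] at h
      exact (Submodule.smul_mem_iff _ (pow_ne_zero _ (by norm_num))).1 h

theorem powerSumSeries_mem_starSpan {n : ℕ} (hn : 0 < n) : powerSumSeries n ∈ starSpan n 1 := by
  have h := Submodule.sub_mem _ (starSymm_mem_starSpan hn)
    (starSpan_anti n one_le_two (starSymm_sub_powerSumSeries_mem hn))
  rw [sub_sub_cancel] at h
  exact (Submodule.smul_mem_iff _ (pow_ne_zero _ (by norm_num))).1 h

/-- Up to products of at least two star functions, `X_G` is a multiple of `𝔰𝔱_n`. -/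
theorem chromaticSymm_sub_starSymm_mem {V : Type*} [Fintype V] [Nonempty V] (G : SimpleGraph V) :
    chromaticSymm G - ((-1) ^ (Fintype.card V - 1) * connectedSpanningSum G) •
      starSymm (Fintype.card V) ∈ starSpan (Fintype.card V) 2 := by
  have h1 := chromaticSymm_sub_mem_starSpan G fun k hk _ => powerSumSeries_mem_starSpan hk
  have h2 := Submodule.smul_mem _ ((-1) ^ (Fintype.card V - 1) * connectedSpanningSum G)
    (starSymm_sub_powerSumSeries_mem (n := Fintype.card V) Fintype.card_pos)
  convert Submodule.sub_mem _ h1 h2 using 1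
  -- The sign relating `𝔰𝔱_n` to `p_n` is its own inverse.
  have hs : (-1 : ℚ) ^ (Fintype.card V - 1) * (-1) ^ (Fintype.card V - 1) = 1 := by
    rw [← mul_pow]; simp
  rw [smul_sub, smul_smul, mul_right_comm, hs, one_mul]
  abel

/-- Elements of `starSpan n 2` are combinations of the `𝔰𝔱_μ` in which `𝔰𝔱_n` does not occur. -/
theorem exists_coeff_of_mem_starSpan_two {n : ℕ} (hn : 0 < n) {x : MvPowerSeries ℕ ℚ}
    (hx : x ∈ starSpan n 2) : ∃ a : n.Partition → ℚ, a (Nat.Partition.indiscrete n) = 0 ∧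
      x = ∑ μ : n.Partition, a μ • starSymmPartition μ := by
  induction hx using Submodule.span_induction with
  | mem x hx =>
    obtain ⟨m, h1, h2, h3, rfl⟩ := hx
    classical
    refine ⟨Pi.single ⟨m, fun {i} hi => h1 i hi, h2⟩ 1, ?_, ?_⟩
    · refine Pi.single_eq_of_ne ?_ _
      intro h
      have := congrArg (fun μ => μ.parts.card) h
      simp [Nat.Partition.indiscrete_parts hn.ne'] at this
      omega
    · simp [Pi.single_apply, starSymmPartition]
  | zero => exact ⟨0, rfl, by simp⟩
  | add x y _ _ hx hy =>
    obtain ⟨a, ha, rfl⟩ := hx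
    obtain ⟨b, hb, rfl⟩ := hy
    exact ⟨a + b, by simp [ha, hb], by simp [add_smul, Finset.sum_add_distrib]⟩
  | smul r x _ hx =>
    obtain ⟨a, ha, rfl⟩ := hx
    exact ⟨r • a, by simp [ha], by simp [mul_smul, Finset.smul_sum]⟩

/-- There is a star expansion of `X_G` whose coefficient at `(n)` is the signed number of
connected spanning subgraphs of `G`. -/
theorem exists_isStarExpansion {V : Type*} [Fintype V] [Nonempty V] (G : SimpleGraph V) :
    ∃ c : (Fintype.card V).Partition → ℚ, IsStarExpansion G c ∧
      c (Nat.Partition.indiscrete _) =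
        (-1) ^ (Fintype.card V - 1) * connectedSpanningSum G := by
  classical
  obtain ⟨a, ha, h⟩ := exists_coeff_of_mem_starSpan_two Fintype.card_pos
    (chromaticSymm_sub_starSymm_mem G)
  refine ⟨a + Pi.single (Nat.Partition.indiscrete _)
    ((-1) ^ (Fintype.card V - 1) * connectedSpanningSum G), ?_, by simp [ha]⟩
  rw [IsStarExpansion]
  simp only [Pi.add_apply, add_smul, Finset.sum_add_distrib, ← h]
  have : starSymmPartition (Nat.Partition.indiscrete (Fintype.card V)) =
      starSymm (Fintype.card V) := by
    simp [starSymmPartition]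
  rw [← this]
  simp [Pi.single_apply, ite_smul]

/-! ### Linear independence and uniqueness of the expansion -/

/-- The exponent vector whose nonzero exponents are the parts of `μ`. -/
noncomputable def partitionExponent {n : ℕ} (μ : n.Partition) : ℕ →₀ ℕ :=
  μ.parts.toList.toFinsupp

/-- The product of the power sums `p_k` over the parts `k` of `μ`. -/
noncomputable def powerSumPartition {n : ℕ} (μ : n.Partition) : MvPowerSeries ℕ ℚ :=
  (μ.parts.map powerSumSeries).prod

theorem partition_toList_get_pos {n : ℕ} (μ : n.Partition) (i : Fin μ.parts.toList.length) :
    0 < μ.parts.toList.get i :=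
  μ.parts_pos (Multiset.mem_toList.1 (List.get_mem _ i))

theorem coeff_powerSumPartition {n : ℕ} (μ : n.Partition) (d : ℕ →₀ ℕ) :
    MvPowerSeries.coeff d (powerSumPartition μ) =
      (Nat.card {g : Fin μ.parts.toList.length → ℕ //
        ∑ i, Finsupp.single (g i) (μ.parts.toList.get i) = d} : ℚ) := by
  rw [← coeff_prod_powerSumSeries _ (partition_toList_get_pos μ), powerSumPartition]
  conv_lhs => rw [← Multiset.coe_toList μ.parts, Multiset.map_coe, Multiset.prod_coe,
    ← List.ofFn_get μ.parts.toList, List.map_ofFn, List.prod_ofFn]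
  rfl

theorem support_partitionExponent {n : ℕ} (μ : n.Partition) :
    (partitionExponent μ).support = Finset.range μ.parts.card := by
  ext i
  rw [partitionExponent, Finsupp.mem_support_iff, List.toFinsupp_apply, Finset.mem_range,
    ← Multiset.length_toList]
  constructor
  · intro h
    by_contra h'
    exact h (List.getD_eq_default _ _ (not_lt.1 h'))
  · intro h
    rw [List.getD_eq_getElem _ _ h]
    exact (partition_toList_get_pos μ ⟨i, h⟩).ne'

theorem map_partitionExponent {n : ℕ} (μ : n.Partition) :
    (Multiset.range μ.parts.card).map (partitionExponent μ) = μ.parts := by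
  conv_rhs => rw [← Multiset.coe_toList μ.parts, ← List.ofFn_get μ.parts.toList]
  rw [← Multiset.length_toList, ← Multiset.coe_range, Multiset.map_coe]
  congr 1
  refine List.ext_get (by simp) fun i h1 h2 => ?_
  simp at h1
  simp [partitionExponent, List.toFinsupp_apply, h1]

/-- If the monomial `x^ν` occurs in `p_μ`, then `ν` is coarser than `μ`: it has fewer parts, or
it is equal to `μ`. -/
theorem card_lt_or_eq_of_coeff_powerSumPartition_ne_zero {n : ℕ} (μ ν : n.Partition)
    (h : MvPowerSeries.coeff (partitionExponent ν) (powerSumPartition μ) ≠ 0) :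
    ν.parts.card < μ.parts.card ∨ μ = ν := by
  classical
  rw [coeff_powerSumPartition] at h
  obtain ⟨⟨g, hg⟩⟩ : Nonempty {g : Fin μ.parts.toList.length → ℕ //
      ∑ i, Finsupp.single (g i) (μ.parts.toList.get i) = partitionExponent ν} := by
    by_contra h'
    rw [not_nonempty_iff] at h'
    simp at h
  -- Every variable occurring in `x^ν` must be chosen by some factor of `p_μ`; if the numbers of
  -- parts agree, `g` is then a bijection matching the parts.
  have himg : Finset.range ν.parts.card ⊆ Finset.univ.image g := by
    rw [← support_partitionExponent, ← hg]
    intro j hj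
    rw [Finsupp.mem_support_iff, Finsupp.finsetSum_apply] at hj
    obtain ⟨i, _, hi⟩ := Finset.exists_ne_zero_of_sum_ne_zero hj
    refine Finset.mem_image.2 ⟨i, Finset.mem_univ i, ?_⟩
    by_contra hne
    exact hi (Finsupp.single_eq_of_ne (Ne.symm hne))
  have hle := Finset.card_le_card himg
  rw [Finset.card_range] at hle
  have hle' : (Finset.univ.image g).card ≤ μ.parts.card := by
    refine Finset.card_image_le.trans ?_
    simp
  rcases (hle.trans hle').lt_or_eq with hlt | heq
  · exact Or.inl hlt
  right
  have hinj : Function.Injective g := by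
    rw [← Set.injOn_univ, ← Finset.coe_univ]
    refine Finset.card_image_iff.1 ?_
    simp
    omega
  have himg' : Finset.range ν.parts.card = Finset.univ.image g :=
    Finset.eq_of_subset_of_card_le himg (by rw [Finset.card_range]; omega)
  have hval : ∀ i, partitionExponent ν (g i) = μ.parts.toList.get i := by
    intro i
    rw [← hg, Finsupp.finsetSum_apply, Finset.sum_eq_single i]
    · simp
    · intro j _ hj
      exact Finsupp.single_eq_of_ne fun h => hj (hinj h).symm
    · simp
  ext1
  rw [← map_partitionExponent ν, ← Finset.range_val, himg',
    Finset.image_val_of_injOn (hinj.injOn), Multiset.map_map]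
  conv_lhs => rw [← Multiset.coe_toList μ.parts, ← List.ofFn_get μ.parts.toList]
  rw [← Fin.univ_val_map]
  exact Multiset.map_congr rfl fun i _ => (hval i).symm

theorem coeff_powerSumPartition_self_ne_zero {n : ℕ} (ν : n.Partition) :
    MvPowerSeries.coeff (partitionExponent ν) (powerSumPartition ν) ≠ 0 := by
  rw [coeff_powerSumPartition]
  have hfin : Finite {g : Fin ν.parts.toList.length → ℕ //
      ∑ i, Finsupp.single (g i) (ν.parts.toList.get i) = partitionExponent ν} := by
    refine Finite.of_injective (fun g i => (⟨g.1 i, ?_⟩ : (partitionExponent ν).support)) ?_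
    · rw [Finsupp.mem_support_iff, ← DFunLike.congr_fun g.2 (g.1 i), Finsupp.finsetSum_apply]
      refine (Finset.sum_pos' (fun _ _ => Nat.zero_le _) ⟨i, Finset.mem_univ i, ?_⟩).ne'
      rw [Finsupp.single_eq_same]
      exact partition_toList_get_pos ν i
    · intro g g' h
      apply Subtype.ext
      funext i
      exact congrArg Subtype.val (congrFun h i)
  have hne : Nonempty {g : Fin ν.parts.toList.length → ℕ //
      ∑ i, Finsupp.single (g i) (ν.parts.toList.get i) = partitionExponent ν} := by
    -- Choose the variable `x_i` in the factor of the `i`-th part.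
    refine ⟨fun i => i, ?_⟩
    ext j
    rw [Finsupp.finsetSum_apply, partitionExponent, List.toFinsupp_apply]
    by_cases hj : j < ν.parts.toList.length
    · rw [List.getD_eq_getElem _ _ hj, Finset.sum_eq_single ⟨j, hj⟩]
      · simp
      · intro i _ hi
        exact Finsupp.single_eq_of_ne fun h => hi (Fin.ext h.symm)
      · simp
    · rw [List.getD_eq_default _ _ (not_lt.1 hj)]
      refine Finset.sum_eq_zero fun i _ => Finsupp.single_eq_of_ne fun h => hj ?_
      rw [h]
      exact i.2
  exact_mod_cast Nat.card_pos.ne'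

/-- In a vanishing combination take `ν` with the most parts among the nonzero coefficients. Any
other `p_μ` containing `x^ν` has more parts, so the coefficient of `x^ν` isolates `ν`. -/
theorem linearIndependent_powerSumPartition (n : ℕ) :
    LinearIndependent ℚ (powerSumPartition : n.Partition → MvPowerSeries ℕ ℚ) := by
  classical
  rw [Fintype.linearIndependent_iff]
  intro a ha
  by_contra! hne
  obtain ⟨ν, hν, hmax⟩ := Finset.exists_max_image
    (Finset.univ.filter fun μ : n.Partition => a μ ≠ 0) (fun μ => μ.parts.card)
    (by obtain ⟨μ, hμ⟩ := hne; exact ⟨μ, by simpa using hμ⟩)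
  have h := congrArg (MvPowerSeries.coeff (partitionExponent ν)) ha
  rw [map_sum, Finset.sum_eq_single ν] at h
  · rw [map_smul, smul_eq_mul, map_zero, mul_eq_zero] at h
    exact h.elim (Finset.mem_filter.1 hν).2 (coeff_powerSumPartition_self_ne_zero ν)
  · intro μ _ hμ
    rw [map_smul, smul_eq_mul]
    by_contra h'
    rcases card_lt_or_eq_of_coeff_powerSumPartition_ne_zero μ ν (right_ne_zero_of_mul h') with h | h
    · exact (hmax μ (by simpa using left_ne_zero_of_mul h')).not_gt h
    · exact hμ h
  · simp

theorem starSpan_zero_eq_span_range (n : ℕ) :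
    starSpan n 0 = Submodule.span ℚ (Set.range (starSymmPartition (n := n))) := by
  unfold starSpan
  congr 1
  ext x
  constructor
  · rintro ⟨m, h1, h2, _, rfl⟩
    exact ⟨⟨m, fun {i} hi => h1 i hi, h2⟩, rfl⟩
  · rintro ⟨μ, rfl⟩
    exact ⟨μ.parts, fun i hi => μ.parts_pos hi, μ.parts_sum, Nat.zero_le _, rfl⟩

theorem powerSumPartition_mem_starSpan {n : ℕ} (μ : n.Partition) :
    powerSumPartition μ ∈ starSpan n 0 := by
  have h := prod_mem_starSpan Finset.univ μ.parts.toList.get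
    (fun i => powerSumSeries (μ.parts.toList.get i))
    (fun i _ => powerSumSeries_mem_starSpan (partition_toList_get_pos μ i))
  have hsum : ∑ i, μ.parts.toList.get i = n := by
    rw [← List.sum_ofFn, List.ofFn_get, ← Multiset.sum_coe, Multiset.coe_toList, μ.parts_sum]
  have hprod : ∏ i, powerSumSeries (μ.parts.toList.get i) = powerSumPartition μ := by
    rw [powerSumPartition]
    conv_rhs => rw [← Multiset.coe_toList μ.parts, Multiset.map_coe, Multiset.prod_coe,
      ← List.ofFn_get μ.parts.toList, List.map_ofFn, List.prod_ofFn]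
    rfl
  rw [hsum, hprod] at h
  exact starSpan_anti n (Nat.zero_le _) h

/-- Dimension count: the span of the `𝔰𝔱_μ` contains the independent family `p_μ`, which has the
same index set. -/
theorem linearIndependent_starSymmPartition (n : ℕ) :
    LinearIndependent ℚ (starSymmPartition : n.Partition → MvPowerSeries ℕ ℚ) := by
  rw [linearIndependent_iff_card_le_finrank_span,
    ← finrank_span_eq_card (linearIndependent_powerSumPartition n), Set.finrank]
  have : Module.Finite ℚ (Submodule.span ℚ (Set.range (starSymmPartition (n := n)))) :=
    Module.Finite.span_of_finite ℚ (Set.finite_range _)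
  refine Submodule.finrank_mono (Submodule.span_le.2 ?_)
  rintro _ ⟨μ, rfl⟩
  rw [SetLike.mem_coe, ← starSpan_zero_eq_span_range]
  exact powerSumPartition_mem_starSpan μ

theorem IsStarExpansion.unique {V : Type*} [Fintype V] {G : SimpleGraph V} {n : ℕ}
    {c c' : n.Partition → ℚ} (h : IsStarExpansion G c) (h' : IsStarExpansion G c') : c' = c := by
  have hsub := (Fintype.linearIndependent_iff.1 (linearIndependent_starSymmPartition n))
    (c' - c) (by
      simp only [Pi.sub_apply, sub_smul, Finset.sum_sub_distrib]
      rw [← h, ← h', sub_self])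
  exact funext fun μ => sub_eq_zero.1 (hsub μ)

/-! ### Signed counts of independent sets of size at most two -/

section Counting

variable {α : Type*} [DecidableEq α]

/-- The sets of the form `{a, b}` with `a ∈ A` and `b ∈ B`. -/
def pairSets (A B : Finset α) : Finset (Finset α) :=
  (A ×ˢ B).image fun p => {p.1, p.2}

theorem mem_pairSets {A B : Finset α} {F : Finset α} :
    F ∈ pairSets A B ↔ ∃ a ∈ A, ∃ b ∈ B, {a, b} = F := by
  simp [pairSets, and_assoc]

theorem card_pairSets {A B : Finset α} (h : Disjoint A B) :
    (pairSets A B).card = A.card * B.card := by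
  rw [pairSets, Finset.card_image_of_injOn, Finset.card_product]
  rintro ⟨a, b⟩ hab ⟨a', b'⟩ hab' heq
  replace heq : ({a, b} : Finset α) = {a', b'} := heq
  simp only [Finset.coe_product, Set.mem_prod, Finset.mem_coe] at hab hab'
  have h1 : a ∈ ({a', b'} : Finset α) := heq ▸ Finset.mem_insert_self a {b}
  have h2 : b ∈ ({a', b'} : Finset α) :=
    heq ▸ Finset.mem_insert_of_mem (Finset.mem_singleton_self b)
  simp only [Finset.mem_insert, Finset.mem_singleton] at h1 h2
  have h3 := Finset.disjoint_left.1 h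
  rcases h1 with rfl | rfl
  · rcases h2 with rfl | rfl
    · exact absurd hab.2 (h3 hab.1)
    · rfl
  · exact absurd hab'.2 (h3 hab.1)

theorem disjoint_pairSets {A B A' B' : Finset α} (hA : Disjoint A A') (hB : Disjoint A B') :
    Disjoint (pairSets A B) (pairSets A' B') := by
  rw [Finset.disjoint_left]
  intro F h h'
  obtain ⟨a, ha, b, hb, rfl⟩ := mem_pairSets.1 h
  obtain ⟨a', ha', b', hb', heq⟩ := mem_pairSets.1 h'
  have h1 : a ∈ ({a', b'} : Finset α) := heq ▸ Finset.mem_insert_self a {b}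
  simp only [Finset.mem_insert, Finset.mem_singleton] at h1
  rcases h1 with rfl | rfl
  · exact Finset.disjoint_left.1 hA ha ha'
  · exact Finset.disjoint_left.1 hB ha hb'

variable (E : Finset α) (I : Finset α → Prop)

/-- The property that any element of `Z` can be added to any set satisfying `I` that does not
meet `Z`. -/
def Augments (Z : Finset α) : Prop :=
  ∀ F, I F → Disjoint Z F → ∀ e ∈ Z, I (insert e F)

variable {E I} (hempty : I ∅) (hmono : ∀ F F', F' ⊆ F → I F → I F')
  (hcard : ∀ F ⊆ E, I F → F.card ≤ 2)

include hempty hcard in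
open Classical in
theorem sum_neg_one_pow_card_of_card_le_two :
    ∑ F ∈ E.powerset.filter I, (-1 : ℚ) ^ F.card =
      1 - (E.filter fun e => I {e}).card + ((E.powersetCard 2).filter I).card := by
  have hsplit : E.powerset.filter I =
      (((E.powersetCard 0).filter I) ∪ ((E.powersetCard 1).filter I)) ∪
        ((E.powersetCard 2).filter I) := by
    ext F
    simp only [Finset.mem_filter, Finset.mem_union, Finset.mem_powerset, Finset.mem_powersetCard]
    constructor
    · rintro ⟨h1, h2⟩
      have := hcard F h1 h2
      interval_cases F.card <;> simp_all
    · tauto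
  have hdisj : ∀ {i j : ℕ}, i ≠ j →
      Disjoint ((E.powersetCard i).filter I) ((E.powersetCard j).filter I) := fun hij =>
    Finset.disjoint_filter_filter (Finset.pairwise_disjoint_powersetCard E hij)
  have hsum : ∀ i, ∑ F ∈ (E.powersetCard i).filter I, (-1 : ℚ) ^ F.card =
      ((E.powersetCard i).filter I).card * (-1) ^ i := by
    intro i
    rw [Finset.sum_congr rfl (g := fun _ => (-1 : ℚ) ^ i), Finset.sum_const, nsmul_eq_mul]
    intro F hF
    rw [(Finset.mem_powersetCard.1 (Finset.mem_filter.1 hF).1).2]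
  rw [hsplit, Finset.sum_union, Finset.sum_union (hdisj (by decide)), hsum, hsum, hsum]
  · have h0 : (E.powersetCard 0).filter I = {∅} := by
      rw [Finset.powersetCard_zero, Finset.filter_singleton, if_pos hempty]
    have h1 : ((E.powersetCard 1).filter I).card = (E.filter fun e => I {e}).card := by
      rw [Finset.powersetCard_one, Finset.filter_map, Finset.card_map]
      rfl
    rw [h0, h1]
    simp
    ring
  · exact Finset.disjoint_union_left.2 ⟨hdisj (by decide), hdisj (by decide)⟩

include hcard in
theorem not_triple {a b c : α} (ha : a ∈ E) (hb : b ∈ E) (hc : c ∈ E) (hab : a ≠ b)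
    (hac : a ≠ c) (hbc : b ≠ c) : ¬ I {a, b, c} := by
  intro h
  have := hcard {a, b, c} (by simp [Finset.insert_subset_iff, ha, hb, hc]) h
  rw [Finset.card_eq_three.2 ⟨a, b, c, hab, hac, hbc, rfl⟩] at this
  omega

-- Because both classes augment, an independent set that misses one of them can be enlarged from it.
-- The bound of two then forces independent pairs to take one element from each class.
include hempty hmono hcard in
open Classical in
theorem sum_neg_one_pow_card_two_classes {C D : Finset α} (hCE : C ⊆ E) (hDE : D ⊆ E)
    (hC0 : C.Nonempty) (hD0 : D.Nonempty)
    (hCD : Disjoint C D) (hC : Augments I C) (hD : Augments I D) :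
    ∑ F ∈ E.powerset.filter I, (-1 : ℚ) ^ F.card = ((C.card : ℚ) - 1) * (D.card - 1) := by
  have hne : ∀ {x y}, x ∈ C → y ∈ D → x ≠ y := fun hx hy h =>
    Finset.disjoint_left.1 hCD hx (h ▸ hy)
  have hpair : ∀ {x y}, x ∈ C → y ∈ D → I {x, y} := by
    intro x y hx hy
    have h1 : I {y} := hD ∅ hempty (Finset.disjoint_empty_right _) y hy
    exact hC {y} h1 (Finset.disjoint_singleton_right.2 fun h => hne h hy rfl) x hx
  have hone : E.filter (fun e => I {e}) = C ∪ D := by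
    ext e
    rw [Finset.mem_filter, Finset.mem_union]
    constructor
    · rintro ⟨he, hI⟩
      by_contra! hn
      -- If `e` lay outside both classes, adding `c` and then `d` would give an independent triple.
      obtain ⟨c, hc⟩ := hC0
      obtain ⟨d, hd⟩ := hD0
      have h1 := hC {e} hI (Finset.disjoint_singleton_right.2 hn.1) c hc
      have h2 := hD {c, e} h1 (by
        simp only [Finset.disjoint_insert_right, Finset.disjoint_singleton_right]
        exact ⟨Finset.disjoint_left.1 hCD hc, hn.2⟩) d hd
      exact not_triple hcard (hDE hd) (hCE hc) he (hne hc hd).symm (by grind) (by grind) h2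
    · rintro (h | h)
      · exact ⟨hCE h, hC ∅ hempty (Finset.disjoint_empty_right _) e h⟩
      · exact ⟨hDE h, hD ∅ hempty (Finset.disjoint_empty_right _) e h⟩
  have htwo : (E.powersetCard 2).filter I = pairSets C D := by
    ext F
    rw [Finset.mem_filter, Finset.mem_powersetCard, mem_pairSets]
    constructor
    · rintro ⟨⟨hFE, hF2⟩, hI⟩
      obtain ⟨a, b, hab, rfl⟩ := Finset.card_eq_two.1 hF2
      have ha : a ∈ C ∪ D := hone ▸ Finset.mem_filter.2
        ⟨hFE (by simp), hmono _ _ (by simp) hI⟩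
      have hb : b ∈ C ∪ D := hone ▸ Finset.mem_filter.2
        ⟨hFE (by simp), hmono _ _ (by simp) hI⟩
      have haE : a ∈ E := hFE (by simp)
      have hbE : b ∈ E := hFE (by simp)
      obtain ⟨c, hc⟩ := hC0
      obtain ⟨d, hd⟩ := hD0
      rcases Finset.mem_union.1 ha with ha | ha <;> rcases Finset.mem_union.1 hb with hb | hb
      · refine absurd (hD _ hI ?_ d hd) (not_triple hcard (hDE hd) haE hbE
          (hne ha hd).symm (hne hb hd).symm hab)
        simp only [Finset.disjoint_insert_right, Finset.disjoint_singleton_right]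
        exact ⟨Finset.disjoint_left.1 hCD ha, Finset.disjoint_left.1 hCD hb⟩
      · exact ⟨a, ha, b, hb, rfl⟩
      · exact ⟨b, hb, a, ha, Finset.pair_comm b a⟩
      · refine absurd (hC _ hI ?_ c hc) (not_triple hcard (hCE hc) haE hbE
          (hne hc ha) (hne hc hb) hab)
        simp only [Finset.disjoint_insert_right, Finset.disjoint_singleton_right]
        exact ⟨Finset.disjoint_right.1 hCD ha, Finset.disjoint_right.1 hCD hb⟩
    · rintro ⟨a, ha, b, hb, rfl⟩
      refine ⟨⟨?_, Finset.card_pair (hne ha hb)⟩, hpair ha hb⟩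
      simp [Finset.insert_subset_iff, hCE ha, hDE hb]
  rw [sum_neg_one_pow_card_of_card_le_two hempty hcard, hone, htwo, card_pairSets hCD,
    Finset.card_union_of_disjoint hCD]
  push_cast
  ring

-- The union of any two classes plays the role of a cycle. Two elements of one class leave the other
-- two untouched, so they could be enlarged to a triple; elements of different classes can be added
-- one at a time.
include hempty hmono hcard in
open Classical in
theorem sum_neg_one_pow_card_three_classes {P Q R : Finset α} (hPE : P ⊆ E) (hQE : Q ⊆ E)
    (hRE : R ⊆ E) (hP0 : P.Nonempty) (hQ0 : Q.Nonempty)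
    (hPQ : Disjoint P Q) (hQR : Disjoint Q R) (hPR : Disjoint P R)
    (hPQ' : Augments I (P ∪ Q)) (hQR' : Augments I (Q ∪ R)) (hPR' : Augments I (P ∪ R)) :
    ∑ F ∈ E.powerset.filter I, (-1 : ℚ) ^ F.card =
      1 - (P.card + Q.card + R.card) +
        (P.card * Q.card + Q.card * R.card + P.card * R.card) := by
  have key : ∀ {A B D : Finset α}, B.Nonempty → A ⊆ E → B ⊆ E → Disjoint A B → Disjoint A D →
      Augments I (B ∪ D) → ∀ {x y}, x ∈ A → y ∈ A → x ≠ y → ¬ I {x, y} := by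
    intro A B D hB0 hA hB hAB hAD hBD x y hx hy hxy hI
    obtain ⟨b, hb⟩ := hB0
    refine not_triple hcard (hB hb) (hA hx) (hA hy) ?_ ?_ hxy
      (hBD _ hI ?_ b (Finset.mem_union_left _ hb))
    · rintro rfl; exact Finset.disjoint_left.1 hAB hx hb
    · rintro rfl; exact Finset.disjoint_left.1 hAB hy hb
    · simp only [Finset.disjoint_insert_right, Finset.disjoint_singleton_right,
        Finset.mem_union, not_or]
      exact ⟨⟨Finset.disjoint_left.1 hAB hx, Finset.disjoint_left.1 hAD hx⟩,
        Finset.disjoint_left.1 hAB hy, Finset.disjoint_left.1 hAD hy⟩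
  have hpair : ∀ {A B D : Finset α}, Disjoint A B → Disjoint B D → Augments I (A ∪ D) →
      Augments I (B ∪ D) → ∀ {x y}, x ∈ A → y ∈ B → I {x, y} := by
    intro A B D hAB hBD hAD' hBD' x y hx hy
    -- First `y` is taken from the cycle `B ∪ D`; it does not meet `A ∪ D`, from which `x` is then
    -- added.
    have h1 : I {y} :=
      hBD' ∅ hempty (Finset.disjoint_empty_right _) y (Finset.mem_union_left _ hy)
    refine hAD' {y} h1 ?_ x (Finset.mem_union_left _ hx)
    rw [Finset.disjoint_singleton_right, Finset.mem_union, not_or]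
    exact ⟨Finset.disjoint_right.1 hAB hy, Finset.disjoint_left.1 hBD hy⟩
  have hone : E.filter (fun e => I {e}) = P ∪ Q ∪ R := by
    ext e
    rw [Finset.mem_filter]
    constructor
    · rintro ⟨he, hI⟩
      by_contra hn
      simp only [Finset.mem_union, not_or] at hn
      obtain ⟨⟨hnP, hnQ⟩, hnR⟩ := hn
      obtain ⟨p, hp⟩ := hP0
      obtain ⟨q, hq⟩ := hQ0
      have hpQ := Finset.disjoint_left.1 hPQ hp
      have hpR := Finset.disjoint_left.1 hPR hp
      have h1 := hPQ' {e} hI (by simp [hnP, hnQ]) p (by simp [hp])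
      have h2 := hQR' {p, e} h1 (by simp [hnQ, hnR, hpQ, hpR]) q (by simp [hq])
      exact not_triple hcard (hQE hq) (hPE hp) he (by grind) (by grind) (by grind) h2
    · intro h
      rw [Finset.mem_union, Finset.mem_union] at h
      rcases h with (h | h) | h
      · exact ⟨hPE h, hPQ' ∅ hempty (Finset.disjoint_empty_right _) e (by simp [h])⟩
      · exact ⟨hQE h, hPQ' ∅ hempty (Finset.disjoint_empty_right _) e (by simp [h])⟩
      · exact ⟨hRE h, hPR' ∅ hempty (Finset.disjoint_empty_right _) e (by simp [h])⟩
  have htwo : (E.powersetCard 2).filter I = pairSets P Q ∪ pairSets Q R ∪ pairSets P R := by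
    ext F
    simp only [Finset.mem_filter, Finset.mem_powersetCard, Finset.mem_union, mem_pairSets]
    have hback : ∀ {A B : Finset α}, A ⊆ E → B ⊆ E → Disjoint A B →
        (∀ {x y}, x ∈ A → y ∈ B → I {x, y}) → (∃ a ∈ A, ∃ b ∈ B, {a, b} = F) →
        (F ⊆ E ∧ F.card = 2) ∧ I F := by
      rintro A B hA hB hAB h ⟨a, ha, b, hb, rfl⟩
      refine ⟨⟨?_, Finset.card_pair ?_⟩, h ha hb⟩
      · simp [Finset.insert_subset_iff, hA ha, hB hb]
      · rintro rfl; exact Finset.disjoint_left.1 hAB ha hb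
    constructor
    · rintro ⟨⟨hFE, hF2⟩, hI⟩
      obtain ⟨a, b, hab, rfl⟩ := Finset.card_eq_two.1 hF2
      have ha : a ∈ P ∪ Q ∪ R := hone ▸ Finset.mem_filter.2
        ⟨hFE (by simp), hmono _ _ (by simp) hI⟩
      have hb : b ∈ P ∪ Q ∪ R := hone ▸ Finset.mem_filter.2
        ⟨hFE (by simp), hmono _ _ (by simp) hI⟩
      simp only [Finset.mem_union] at ha hb
      have hswap := Finset.pair_comm b a
      rcases ha with (ha | ha) | ha <;> rcases hb with (hb | hb) | hb
      · exact absurd hI (key hQ0 hPE hQE hPQ hPR hQR' ha hb hab)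
      · exact Or.inl (Or.inl ⟨a, ha, b, hb, rfl⟩)
      · exact Or.inr ⟨a, ha, b, hb, rfl⟩
      · exact Or.inl (Or.inl ⟨b, hb, a, ha, hswap⟩)
      · exact absurd hI (key hP0 hQE hPE hPQ.symm hQR hPR' ha hb hab)
      · exact Or.inl (Or.inr ⟨a, ha, b, hb, rfl⟩)
      · exact Or.inr ⟨b, hb, a, ha, hswap⟩
      · exact Or.inl (Or.inr ⟨b, hb, a, ha, hswap⟩)
      · exact absurd hI (key hP0 hRE hPE hPR.symm hQR.symm hPQ' ha hb hab)
    · rintro ((h | h) | h)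
      · exact hback hPE hQE hPQ (hpair hPQ hQR hPR' hQR') h
      · refine hback hQE hRE hQR (hpair hQR hPR.symm ?_ ?_) h
        · rwa [Finset.union_comm]
        · rwa [Finset.union_comm]
      · refine hback hPE hRE hPR (hpair hPR hQR.symm hPQ' ?_) h
        rwa [Finset.union_comm]
  have hd1 : Disjoint (pairSets P Q) (pairSets Q R) := disjoint_pairSets hPQ hPR
  have hd2 : Disjoint (pairSets P Q ∪ pairSets Q R) (pairSets P R) := by
    rw [Finset.disjoint_union_left]
    refine ⟨?_, disjoint_pairSets hPQ.symm hQR⟩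
    -- Both families use `P`; they are separated by `Q`, which has to be put in first position.
    have hcomm : pairSets P Q = pairSets Q P := by
      ext F
      simp only [mem_pairSets]
      constructor <;> rintro ⟨a, ha, b, hb, rfl⟩ <;> exact ⟨b, hb, a, ha, Finset.pair_comm _ _⟩
    rw [hcomm]
    exact disjoint_pairSets hPQ.symm hQR
  have hd3 : Disjoint (P ∪ Q) R := Finset.disjoint_union_left.2 ⟨hPR, hQR⟩
  rw [sum_neg_one_pow_card_of_card_le_two hempty hcard, hone, htwo,
    Finset.card_union_of_disjoint hd2, Finset.card_union_of_disjoint hd1, card_pairSets hPQ,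
    card_pairSets hQR, card_pairSets hPR, Finset.card_union_of_disjoint hd3,
    Finset.card_union_of_disjoint hPQ]
  push_cast
  ring

end Counting

/-! ### Removable edge sets of a bicyclic graph -/

section CoConnected

variable {V : Type*} {G : SimpleGraph V}

theorem SimpleGraph.Connected.deleteEdges_mono {F F' : Set (Sym2 V)} (h : F' ⊆ F)
    (hF : (G.deleteEdges F).Connected) : (G.deleteEdges F').Connected :=
  hF.mono (SimpleGraph.deleteEdges_anti h)

/-- Deleting an edge of a cycle that survives in `G - F` keeps `G - F` connected. -/
theorem SimpleGraph.Walk.IsCycle.augments [DecidableEq V] {u : V} {C : G.Walk u u}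
    (hC : C.IsCycle) :
    Augments (fun F : Finset (Sym2 V) => (G.deleteEdges (F : Set (Sym2 V))).Connected)
      C.edges.toFinset := by
  intro F hF hdisj e he
  rw [List.mem_toFinset] at he
  have hC' : ∀ e ∈ C.edges, e ∈ (G.deleteEdges (F : Set (Sym2 V))).edgeSet := by
    intro e he
    rw [SimpleGraph.edgeSet_deleteEdges]
    exact ⟨C.edges_subset_edgeSet he,
      fun h => Finset.disjoint_left.1 hdisj (List.mem_toFinset.2 he) h⟩
  have hbr : ¬ (G.deleteEdges (F : Set (Sym2 V))).IsBridge e := by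
    rw [SimpleGraph.isBridge_iff_forall_cycle_notMem (hC' e he)]
    push Not
    exact ⟨u, C.transfer _ hC', hC.transfer hC', by rwa [SimpleGraph.Walk.edges_transfer]⟩
  induction e with
  | h x y =>
    have := hF.connected_delete_edge_of_not_isBridge hbr
    rw [SimpleGraph.deleteEdges_deleteEdges] at this
    change (G.deleteEdges _).Connected
    rwa [Finset.coe_insert, Set.insert_eq, Set.union_comm]

theorem SimpleGraph.Walk.IsTrail.card_edges_toFinset [DecidableEq V] {u v : V} {p : G.Walk u v}
    (hp : p.IsTrail) : p.edges.toFinset.card = p.length := by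
  rw [List.toFinset_card_of_nodup hp.edges_nodup, SimpleGraph.Walk.length_edges]

theorem SimpleGraph.Walk.edges_toFinset_nonempty [DecidableEq V] {u v : V} {p : G.Walk u v}
    (hp : 1 ≤ p.length) : p.edges.toFinset.Nonempty := by
  rw [List.toFinset_nonempty_iff, ← List.length_pos_iff, SimpleGraph.Walk.length_edges]
  exact hp

/-- Two paths with common ends that share no edge and no inner vertex form a cycle. -/
theorem SimpleGraph.Walk.IsPath.isCycle_append_reverse {u v : V} {p q : G.Walk u v}
    (hp : p.IsPath) (hq : q.IsPath) (hp1 : 1 ≤ p.length) (hq1 : 1 ≤ q.length)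
    (he : p.edges.Disjoint q.edges)
    (hs : ∀ x ∈ p.support, x ∈ q.support → x = u ∨ x = v) :
    (p.append q.reverse).IsCycle := by
  refine hp.isCycle_append hq.reverse ?_ ?_
  · intro x hx hx'
    have h1 := List.mem_of_mem_tail hx
    have h2 := List.mem_of_mem_tail hx'
    rw [SimpleGraph.Walk.support_reverse, List.mem_reverse] at h2
    rcases hs x h1 h2 with rfl | rfl
    · have := hp.support_nodup
      rw [← SimpleGraph.Walk.cons_tail_support, List.nodup_cons] at this
      exact this.1 hx
    · have := hq.reverse.support_nodup
      rw [← SimpleGraph.Walk.cons_tail_support, List.nodup_cons] at this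
      exact this.1 hx'
  · by_contra! h
    rw [SimpleGraph.Walk.length_reverse] at h
    -- The degenerate case: two paths of length one would both use the edge `uv`, against
    -- edge-disjointness.
    have hone : ∀ r : G.Walk u v, r.length = 1 → s(u, v) ∈ r.edges := by
      intro r hr
      cases r with
      | nil => simp at hr
      | cons _ r =>
        cases r with
        | nil => simp
        | cons => simp at hr
    exact he (hone p (by omega)) (hone q (by omega))

theorem SimpleGraph.Walk.edges_toFinset_subset [DecidableEq V] [Fintype G.edgeSet] {u v : V}
    (p : G.Walk u v) : p.edges.toFinset ⊆ G.edgeFinset := by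
  intro e he
  rw [SimpleGraph.mem_edgeFinset]
  exact p.edges_subset_edgeSet (List.mem_toFinset.1 he)

theorem SimpleGraph.Connected.deleteEdges_empty (hG : G.Connected) :
    (G.deleteEdges ((∅ : Finset (Sym2 V)) : Set (Sym2 V))).Connected := by
  rwa [Finset.coe_empty, SimpleGraph.deleteEdges_empty]

variable [Fintype V]

open Classical in
/-- Summing over complements. -/
theorem connectedSpanningSum_eq_sum_deleteEdges (G : SimpleGraph V) :
    connectedSpanningSum G = (-1 : ℚ) ^ G.edgeFinset.card *
      ∑ F ∈ G.edgeFinset.powerset.filter fun F : Finset (Sym2 V) =>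
        (G.deleteEdges (F : Set (Sym2 V))).Connected, (-1 : ℚ) ^ F.card := by
  have hgraph : ∀ F : Finset (Sym2 V), SimpleGraph.fromEdgeSet
      ((G.edgeFinset \ F : Finset (Sym2 V)) : Set (Sym2 V)) =
      G.deleteEdges (F : Set (Sym2 V)) := by
    intro F
    rw [← SimpleGraph.edgeSet_inj, SimpleGraph.edgeSet_fromEdgeSet,
      SimpleGraph.edgeSet_deleteEdges, Finset.coe_sdiff, SimpleGraph.coe_edgeFinset]
    refine Set.Subset.antisymm Set.sdiff_subset fun e he => ⟨he, fun h => ?_⟩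
    exact G.not_isDiag_of_mem_edgeSet he.1 h
  rw [connectedSpanningSum, Finset.mul_sum]
  have hsub : ∀ F ⊆ G.edgeFinset, G.edgeFinset \ (G.edgeFinset \ F) = F := fun F hF =>
    Finset.sdiff_sdiff_eq_self hF
  refine Finset.sum_nbij' (fun S => G.edgeFinset \ S) (fun F => G.edgeFinset \ F) ?_ ?_ ?_ ?_ ?_
  · intro S hS
    rw [Finset.mem_filter, Finset.mem_powerset] at hS ⊢
    refine ⟨Finset.sdiff_subset, ?_⟩
    rw [← hgraph, hsub S hS.1]
    exact hS.2
  · intro F hF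
    rw [Finset.mem_filter, Finset.mem_powerset] at hF ⊢
    refine ⟨Finset.sdiff_subset, ?_⟩
    rw [hgraph]
    exact hF.2
  · intro S hS
    exact hsub S (Finset.mem_powerset.1 (Finset.mem_filter.1 hS).1)
  · intro F hF
    exact hsub F (Finset.mem_powerset.1 (Finset.mem_filter.1 hF).1)
  · intro S hS
    have hSE := Finset.mem_powerset.1 (Finset.mem_filter.1 hS).1
    -- The number of edges of `G` plus `|E \ S|` has the parity of `|S|`.
    rw [← Finset.card_sdiff_add_card_eq_card hSE, pow_add, mul_right_comm, ← mul_pow]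
    simp

theorem IsBicyclic.card_edgeFinset [Fintype G.edgeSet] (hG : IsBicyclic G) :
    G.edgeFinset.card = Fintype.card V + 1 := by
  rw [← Nat.card_eq_fintype_card, ← hG.2, ← SimpleGraph.coe_edgeFinset, Set.ncard_coe_finset]

/-- A connected graph on `n` vertices keeps at least `n - 1` of the `n + 1` edges. -/
theorem IsBicyclic.card_le_two [Fintype G.edgeSet] (hG : IsBicyclic G) (F : Finset (Sym2 V))
    (hF : F ⊆ G.edgeFinset) (hconn : (G.deleteEdges (F : Set (Sym2 V))).Connected) :
    F.card ≤ 2 := by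
  classical
  have h := hconn.card_vert_le_card_edgeSet_add_one
  have h2 : Nat.card (G.deleteEdges (F : Set (Sym2 V))).edgeSet = (G.edgeFinset \ F).card := by
    rw [SimpleGraph.edgeSet_deleteEdges, Nat.card_coe_set_eq, ← SimpleGraph.coe_edgeFinset,
      ← Finset.coe_sdiff, Set.ncard_coe_finset]
  rw [h2, Nat.card_eq_fintype_card] at h
  have h3 := Finset.card_sdiff_add_card_eq_card hF
  rw [hG.card_edgeFinset] at h3
  omega

open Classical in
theorem IsBicyclic.signed_connectedSpanningSum (hG : IsBicyclic G) :
    (-1) ^ (Fintype.card V - 1) * connectedSpanningSum G =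
      ∑ F ∈ G.edgeFinset.powerset.filter fun F : Finset (Sym2 V) =>
        (G.deleteEdges (F : Set (Sym2 V))).Connected, (-1 : ℚ) ^ F.card := by
  have := hG.1.nonempty
  obtain ⟨m, hm⟩ := Nat.exists_eq_succ_of_ne_zero (Fintype.card_ne_zero (α := V))
  -- With `n = m + 1` the total exponent is `(n - 1) + (n + 1) = 2(m + 1)`.
  rw [connectedSpanningSum_eq_sum_deleteEdges, hG.card_edgeFinset, hm, ← mul_assoc, ← pow_add,
    Even.neg_one_pow ⟨m + 1, by omega⟩, one_mul]

theorem IsBicyclicTypeI.signed_connectedSpanningSum {s t : ℕ} (hG : IsBicyclicTypeI G s t) :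
    (-1) ^ (Fintype.card V - 1) * connectedSpanningSum G = ((s : ℚ) - 1) * ((t : ℚ) - 1) := by
  classical
  obtain ⟨hG, H, -, u, v, C, D, P, hC, hD, -, rfl, rfl, -, -, hCD, -⟩ := hG
  -- A common edge would have two distinct ends on both cycles, which share at most one vertex.
  have hdisj : Disjoint C.edges.toFinset D.edges.toFinset := by
    rw [Finset.disjoint_left]
    intro e h1 h2
    rw [List.mem_toFinset] at h1 h2
    induction e with
    | h x y =>
      have hx := hCD x (C.fst_mem_support_of_mem_edges h1) (D.fst_mem_support_of_mem_edges h2)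
      have hy := hCD y (C.snd_mem_support_of_mem_edges h1) (D.snd_mem_support_of_mem_edges h2)
      exact (C.adj_of_mem_edges h1).ne (hx.1.trans hy.1.symm)
  have h := sum_neg_one_pow_card_two_classes (hG.1.deleteEdges_empty)
    (fun F F' h hF => hF.deleteEdges_mono h) hG.card_le_two
    C.edges_toFinset_subset D.edges_toFinset_subset
    (SimpleGraph.Walk.edges_toFinset_nonempty (by have := hC.three_le_length; omega))
    (SimpleGraph.Walk.edges_toFinset_nonempty (by have := hD.three_le_length; omega))
    hdisj hC.augments hD.augments
  rw [hC.isTrail.card_edges_toFinset, hD.isTrail.card_edges_toFinset] at h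
  rw [hG.signed_connectedSpanningSum]
  convert h

theorem IsBicyclicTypeII.signed_connectedSpanningSum {s t ℓ : ℕ}
    (hG : IsBicyclicTypeII G s t ℓ) :
    (-1) ^ (Fintype.card V - 1) * connectedSpanningSum G =
      ((s : ℚ) - 1) * ((t : ℚ) - 1) - 2 * ((ℓ.choose 2 : ℕ) : ℚ) := by
  classical
  obtain ⟨hG, H, -, u, v, P, Q, R, hP, hQ, hR, hP1, hQ1, hR1, rfl, rfl, rfl, hPQ, hQR, hPR,
    hPQ', hQR', hPR', -⟩ := hG
  have hdisj : ∀ {p q : G.Walk u v}, p.edges.Disjoint q.edges →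
      Disjoint p.edges.toFinset q.edges.toFinset := fun h => List.disjoint_toFinset_iff_disjoint.2 h
  have haug : ∀ {p q : G.Walk u v}, (p.append q.reverse).IsCycle →
      Augments (fun F : Finset (Sym2 V) => (G.deleteEdges (F : Set (Sym2 V))).Connected)
        (p.edges.toFinset ∪ q.edges.toFinset) := by
    intro p q h
    have := h.augments
    rwa [SimpleGraph.Walk.edges_append, SimpleGraph.Walk.edges_reverse, List.toFinset_append,
      List.toFinset_reverse] at this
  have h := sum_neg_one_pow_card_three_classes (hG.1.deleteEdges_empty)
    (fun F F' h hF => hF.deleteEdges_mono h) hG.card_le_two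
    P.edges_toFinset_subset Q.edges_toFinset_subset R.edges_toFinset_subset
    (SimpleGraph.Walk.edges_toFinset_nonempty hP1) (SimpleGraph.Walk.edges_toFinset_nonempty hQ1)
    (hdisj hPQ) (hdisj hQR) (hdisj hPR)
    (haug (hP.isCycle_append_reverse hQ hP1 hQ1 hPQ hPQ'))
    (haug (hQ.isCycle_append_reverse hR hQ1 hR1 hQR hQR'))
    (haug (hP.isCycle_append_reverse hR hP1 hR1 hPR hPR'))
  rw [hP.isTrail.card_edges_toFinset, hQ.isTrail.card_edges_toFinset,
    hR.isTrail.card_edges_toFinset] at h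
  rw [hG.signed_connectedSpanningSum]
  refine Eq.trans (by congr!) (h.trans ?_)
  -- For `s = k + ℓ` and `t = ℓ + m`, the product `(s - 1)(t - 1)` exceeds the count by `ℓ² - ℓ`,
  -- which is twice the binomial coefficient.
  rw [Nat.cast_choose_two]
  push_cast
  ring

end CoConnected

/-! ### The main theorem -/

theorem mainTheorem10 {V : Type*} [Fintype V] (G : SimpleGraph V) (n : ℕ)
    (hn : Fintype.card V = n) (hG : IsBicyclic G) :
    ∃ c : n.Partition → ℚ,
      IsStarExpansion G c ∧ (∀ c' : n.Partition → ℚ, IsStarExpansion G c' → c' = c) ∧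
      (∀ s t : ℕ, 3 ≤ s → 3 ≤ t → IsBicyclicTypeI G s t →
        c (Nat.Partition.indiscrete n) = ((s : ℚ) - 1) * ((t : ℚ) - 1)) ∧
      (∀ s t ℓ : ℕ, 3 ≤ s → 3 ≤ t → 1 ≤ ℓ → IsBicyclicTypeII G s t ℓ →
        c (Nat.Partition.indiscrete n) =
          ((s : ℚ) - 1) * ((t : ℚ) - 1) - 2 * ((ℓ.choose 2 : ℕ) : ℚ)) := by
  subst hn
  have := hG.1.nonempty
  obtain ⟨c, hc, hcn⟩ := exists_isStarExpansion G
  refine ⟨c, hc, fun c' hc' => hc.unique hc', ?_, ?_⟩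
  · intro s t _ _ h
    rw [hcn, h.signed_connectedSpanningSum]
  · intro s t ℓ _ _ _ h
    rw [hcn, h.signed_connectedSpanningSum]
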